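/- All rings have an identity. A commutative ring $R$ is projective-free if every finitely generated projective $R$-module is free. For a ring $S$ with Jacobson radical $J(S)$ put $J^{\#}(S)=\{s\in S \mid s^n\in J(S)\text{ for some integer } n\ge 1\}$; an element $a\in S$ is strongly $J^{\#}$-clean if there is an idempotent $e\in S$ with $ea=ae$ and $a-e\in J^{\#}(S)$. **Theorem 3.4.** Let $R$ be a projective-free ring, let $A(x)=(a_{ij}(x))\in M_3(R[[x]])$, and let $m\ge 1$ be an integer. Then the following are equivalent: 1. $A(x)$ is strongly $J^{\#}$-clean in $M_3(R[[x]])$. 2. The image of $A(x)$ in $M_3\big(R[[x]]/(x^m)\big)$ is strongly $J^{\#}$-clean. 3. $A(0)=(a_{ij}(0))$ is strongly $J^{\#}$-clean in $M_3(R)$. -/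

import Mathlib

universe u

/-- The set `J^#(R)` of elements of a (not necessarily commutative) ring `R` some power of which
lies in the Jacobson radical of `R`. -/
def JSharp (R : Type u) [Ring R] : Set R :=
  {x | ∃ n : ℕ, 1 ≤ n ∧ x ^ n ∈ Ring.jacobson R}

/-- An element `a` of a ring is strongly `J^#`-clean if there is an idempotent `e`, commuting
with `a`, such that `a - e` lies in `J^#(R)`. -/
def IsStronglyJSharpClean {R : Type u} [Ring R] (a : R) : Prop :=
  ∃ e : R, IsIdempotentElem e ∧ a - e ∈ JSharp R ∧ e * a = a * e

/-- A commutative ring is projective-free if every finitely generated projective module over it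
is free. Since a finitely generated module is isomorphic to a quotient of some `R ^ n`, it is
enough to let the modules range over the universe of `R`. -/
def IsProjectiveFree (R : Type u) [CommRing R] : Prop :=
  ∀ (P : Type u) [AddCommGroup P] [Module R P],
    Module.Finite R P → Module.Projective R P → Module.Free R P

/-! Surjective ring maps carry Jacobson radicals into Jacobson radicals, so cleanness descends to
quotients. For the way back from `A(0)`, the point is that the idempotent `E₀` is a polynomial `g`
in `A(0)`: this holds modulo the radical by a Bézout identity, and Nakayama removes the error. Then
`g(A)` commutes with `A` and is idempotent modulo `X`; Newton iteration refines it to an idempotent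
`E` commuting with `A`, and radical membership is read off constant terms. -/

/-! ### Commuting idempotents as polynomials. -/

theorem mul_pow_eq_mul_pow {C : Type*} [CommRing C] {e x y : C} (h : e * x = e * y) (n : ℕ) :
    e * x ^ n = e * y ^ n := by
  induction n with
  | zero => simp
  | succ n ih => linear_combination y * ih + x ^ n * h

/-- In a finite commutative algebra generated by `a` and an idempotent `e` such that `a - e` is
nilpotent modulo the Jacobson radical of the base, the idempotent is a polynomial in `a`. -/
theorem IsIdempotentElem.mem_adjoin_of_sub_pow_mem {R C : Type*} [CommRing R] [CommRing C]
    [Algebra R C] [Module.Finite R C] {a e : C} (he : IsIdempotentElem e)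
    (hC : Algebra.adjoin R {a, e} = ⊤) (n : ℕ)
    (h : (a - e) ^ n ∈ (Ring.jacobson R).map (algebraMap R C)) : e ∈ Algebra.adjoin R {a} := by
  set I := (Ring.jacobson R).map (algebraMap R C)
  set S := Algebra.adjoin R {a}
  have haS : a ∈ S := Algebra.subset_adjoin rfl
  -- Modulo `I`, `(1 - a) ^ n` dies on `eC` and `a ^ n` on `(1 - e)C`. With `u X^n + v (1 - X)^n =
  -- 1`, the element `u(a) a^n` is thus `1` on the first part and `0` on the second.
  obtain ⟨d, hd, hed⟩ : ∃ d ∈ S, e - d ∈ I := by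
    have hcop : IsCoprime (Polynomial.X ^ n : Polynomial R) ((1 - Polynomial.X) ^ n) :=
      IsCoprime.pow ⟨1, 1, by ring⟩
    obtain ⟨u, v, huv⟩ := hcop
    have huv' := congrArg (Polynomial.aeval a) huv
    simp only [map_add, map_mul, map_pow, map_sub, map_one, Polynomial.aeval_X] at huv'
    have he' : e * e = e := he
    have h1 : e * (1 - a) ^ n = e * (e - a) ^ n :=
      mul_pow_eq_mul_pow (by linear_combination -he') n
    have h2 : (1 - e) * a ^ n = (1 - e) * (a - e) ^ n :=
      mul_pow_eq_mul_pow (by linear_combination -he') n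
    have h3 : (e - a) ^ n ∈ I := by
      rw [← neg_sub, neg_pow]
      exact I.mul_mem_left _ h
    refine ⟨Polynomial.aeval a u * a ^ n,
      S.mul_mem (Polynomial.aeval_mem_adjoin_singleton R a) (S.pow_mem haS n), ?_⟩
    have : e - Polynomial.aeval a u * a ^ n =
        Polynomial.aeval a v * e * (e - a) ^ n
          - Polynomial.aeval a u * (1 - e) * (a - e) ^ n := by
      linear_combination (-e) * huv' + Polynomial.aeval a v * h1 - Polynomial.aeval a u * h2
    rw [this]
    exact I.sub_mem (I.mul_mem_left _ h3) (I.mul_mem_left _ h)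
  have key : ∀ c ∈ Algebra.adjoin R {a, e}, ∃ d ∈ S, c - d ∈ I := by
    intro c hc
    induction hc using Algebra.adjoin_induction with
    | mem x hx =>
      rcases hx with rfl | hx
      · exact ⟨x, haS, by simp⟩
      · obtain rfl : x = e := hx
        exact ⟨d, hd, hed⟩
    | algebraMap r => exact ⟨_, S.algebraMap_mem r, by simp⟩
    | add x y _ _ hx hy =>
      obtain ⟨x', hx', hx⟩ := hx
      obtain ⟨y', hy', hy⟩ := hy
      exact ⟨x' + y', S.add_mem hx' hy', by
        convert I.add_mem hx hy using 1
        ring⟩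
    | mul x y _ _ hx hy =>
      obtain ⟨x', hx', hx⟩ := hx
      obtain ⟨y', hy', hy⟩ := hy
      exact ⟨x' * y', S.mul_mem hx' hy', by
        convert I.add_mem (I.mul_mem_left y hx) (I.mul_mem_left x' hy) using 1
        ring⟩
  -- Nakayama: `C` is finite over `R` and equals `S + J(R) C`.
  have hle : (⊤ : Submodule R C) ≤ Subalgebra.toSubmodule S := by
    refine Submodule.le_of_le_smul_of_le_jacobson_bot (I := Ring.jacobson R)
      Module.Finite.fg_top (Ideal.jacobson_bot (R := R)).ge fun c _ => ?_
    obtain ⟨d, hd, hcd⟩ := key c (hC ▸ Algebra.mem_top)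
    rw [Ideal.smul_top_eq_map]
    exact Submodule.mem_sup.2 ⟨d, hd, c - d, hcd, by abel⟩
  exact hle (Submodule.mem_top (x := e))

theorem Matrix.map_mem_jacobson {n R S : Type*} [Fintype n] [DecidableEq n] [Ring R] [Ring S]
    (f : R →+* S) (hf : Function.Surjective f) {M : Matrix n n R}
    (hM : M ∈ Ring.jacobson (Matrix n n R)) : M.map f ∈ Ring.jacobson (Matrix n n S) := by
  have hs : RingHomSurjective (f.mapMatrix (m := n)) := ⟨fun M => by
    choose g hg using hf
    exact ⟨M.map g, by ext; simp [hg]⟩⟩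
  exact Ring.le_comap_jacobson f.mapMatrix hM

theorem Matrix.mem_jacobson_iff {n R : Type*} [Fintype n] [DecidableEq n] [Ring R]
    {M : Matrix n n R} :
    M ∈ Ring.jacobson (Matrix n n R) ↔ ∀ i j, M i j ∈ Ring.jacobson R := by
  have h := SetLike.ext_iff.1 (TwoSidedIdeal.matrix_jacobson_bot (R := R) (n := n)) M
  rw [TwoSidedIdeal.mem_matrix] at h
  simp only [← TwoSidedIdeal.mem_asIdeal, TwoSidedIdeal.asIdeal_jacobson,
    TwoSidedIdeal.bot_asIdeal, Ideal.jacobson_bot] at h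
  exact h.symm

/-- Over the reduced ring `R / J(R)`, a nilpotent matrix has characteristic polynomial a power of
`X`. -/
theorem Matrix.charpoly_sub_X_pow_mem {n R : Type*} [Fintype n] [DecidableEq n] [CommRing R]
    {W : Matrix n n R} {k : ℕ} (hW : W ^ k ∈ Ring.jacobson (Matrix n n R)) :
    W.charpoly - Polynomial.X ^ Fintype.card n ∈ (Ring.jacobson R).map Polynomial.C := by
  have : IsReduced (R ⧸ Ring.jacobson R) := by
    rw [← Ideal.isRadical_iff_quotient_reduced, ← Ideal.jacobson_bot]
    exact Ideal.isRadical_jacobson _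
  let f := Ideal.Quotient.mk (Ring.jacobson R)
  have hnil : IsNilpotent (f.mapMatrix W) := by
    refine ⟨k, ?_⟩
    rw [← map_pow]
    ext i j
    exact Ideal.Quotient.eq_zero_iff_mem.2 (Matrix.mem_jacobson_iff.1 hW i j)
  have h0 := Polynomial.isNilpotent_iff.1 (Matrix.isNilpotent_charpoly_sub_pow_of_isNilpotent hnil)
  rw [RingHom.mapMatrix_apply, Matrix.charpoly_map] at h0
  rw [Ideal.mem_map_C_iff]
  intro i
  rw [← Ideal.Quotient.eq_zero_iff_mem]
  simpa [f] using (h0 i).eq_zero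

open scoped IsMulCommutative in
/-- An idempotent commuting with `A` and differing from `A` by a matrix which is nilpotent modulo
the Jacobson radical is a polynomial in `A`. -/
theorem Matrix.exists_aeval_eq_of_isIdempotentElem {n R : Type*} [Fintype n] [DecidableEq n]
    [CommRing R] {A E : Matrix n n R} (hE : IsIdempotentElem E) (hEA : E * A = A * E) {k : ℕ}
    (hk : (A - E) ^ k ∈ Ring.jacobson (Matrix n n R)) :
    ∃ g : Polynomial R, Polynomial.aeval A g = E := by
  have hcomm : ∀ a ∈ ({A, E} : Set (Matrix n n R)), ∀ b ∈ ({A, E} : Set (Matrix n n R)),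
      a * b = b * a := by
    rintro a (rfl | rfl) b (rfl | rfl) <;> simp [hEA]
  set C := Algebra.adjoin R ({A, E} : Set (Matrix n n R))
  have : IsMulCommutative C := Algebra.isMulCommutative_adjoin R hcomm
  have hinj : Function.Injective C.val := Subtype.val_injective
  have hA : A ∈ C := Algebra.subset_adjoin (by simp)
  have hE' : E ∈ C := Algebra.subset_adjoin (by simp)
  have hint : Algebra.IsIntegral R C :=
    ⟨fun x => (isIntegral_algHom_iff C.val hinj).1 (Matrix.isIntegral _)⟩
  have hft : Algebra.FiniteType R C :=
    (Subalgebra.fg_iff_finiteType C).1 (Subalgebra.fg_def.2 ⟨{A, E}, by simp, rfl⟩)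
  have hfin : Module.Finite R C := Algebra.IsIntegral.finite
  let a : C := ⟨A, hA⟩
  let e : C := ⟨E, hE'⟩
  have he : IsIdempotentElem e := Subtype.ext hE
  have htop : Algebra.adjoin R {a, e} = ⊤ := by
    rw [← Algebra.adjoin_adjoin_coe_preimage (R := R) (s := {A, E})]
    congr 1
    ext x
    simp [a, e, Subtype.ext_iff]
  -- Entries in `J(R)` do not by themselves place a matrix in `J(R) C`; Cayley–Hamilton does,
  -- writing the power through lower powers of `a - e` with coefficients in `J(R)`.
  have hpow : (a - e) ^ Fintype.card n ∈ (Ring.jacobson R).map (algebraMap R C) := by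
    have h0 : Polynomial.aeval (a - e) (A - E).charpoly = 0 := by
      apply hinj
      rw [← Polynomial.aeval_algHom_apply, map_zero]
      exact Matrix.aeval_self_charpoly _
    have h1 := Ideal.mem_map_of_mem (Polynomial.aeval (R := R) (a - e)).toRingHom
      (Matrix.charpoly_sub_X_pow_mem hk)
    rw [Ideal.map_map] at h1
    have h2 : (Polynomial.aeval (R := R) (a - e)).toRingHom.comp Polynomial.C
        = algebraMap R C := by
      ext r
      simp
    rw [h2] at h1
    simpa [h0] using h1
  have hmem := he.mem_adjoin_of_sub_pow_mem htop _ hpow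
  rw [Algebra.adjoin_singleton_eq_range_aeval] at hmem
  obtain ⟨g, hg⟩ := hmem
  refine ⟨g, ?_⟩
  exact (Polynomial.aeval_algHom_apply C.val a g).trans (congrArg C.val hg)

theorem IsStronglyJSharpClean.matrix_map {n R S : Type*} [Fintype n] [DecidableEq n] [Ring R]
    [Ring S] (f : R →+* S) (hf : Function.Surjective f) {A : Matrix n n R}
    (hA : IsStronglyJSharpClean A) : IsStronglyJSharpClean (A.map f) := by
  obtain ⟨E, hE, ⟨k, hk, hJ⟩, hEA⟩ := hA
  refine ⟨f.mapMatrix E, hE.map f.mapMatrix, ⟨k, hk, ?_⟩, ?_⟩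
  · have := Matrix.map_mem_jacobson f hf hJ
    rwa [← RingHom.mapMatrix_apply, map_pow, map_sub] at this
  · have := congrArg f.mapMatrix hEA
    rwa [map_mul, map_mul] at this

/-! ### `X`-adic lifting of idempotents. -/

theorem PowerSeries.matrix_eq_X_pow_smul_of_coeff_eq_zero {n R : Type*} [CommRing R]
    {M : Matrix n n (PowerSeries R)} {k : ℕ}
    (h : ∀ i j, ∀ c < k, PowerSeries.coeff c (M i j) = 0) :
    ∃ Y : Matrix n n (PowerSeries R), M = (PowerSeries.X : PowerSeries R) ^ k • Y := by
  choose Y hY using fun i j => PowerSeries.X_pow_dvd_iff.2 (h i j)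
  exact ⟨Matrix.of Y, by ext1 i j; simpa using hY i j⟩

theorem PowerSeries.matrix_coeff_X_pow_smul {n R : Type*} [CommRing R]
    (Y : Matrix n n (PowerSeries R)) {k c : ℕ} (hc : c < k) (i j : n) :
    PowerSeries.coeff c (((PowerSeries.X : PowerSeries R) ^ k • Y) i j) = 0 :=
  PowerSeries.X_pow_dvd_iff.1 (Dvd.intro (Y i j) rfl) c hc

theorem PowerSeries.matrix_eq_zero_of_forall_X_pow_smul {n R : Type*} [CommRing R]
    {M : Matrix n n (PowerSeries R)}
    (h : ∀ k : ℕ, ∃ Y : Matrix n n (PowerSeries R),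
      M = (PowerSeries.X : PowerSeries R) ^ (k + 1) • Y) : M = 0 := by
  ext i j c
  obtain ⟨Y, hY⟩ := h c
  rw [hY, PowerSeries.matrix_coeff_X_pow_smul Y c.lt_succ_self]
  simp

/-- The Newton iteration `e ↦ 3 e ^ 2 - 2 e ^ 3` towards an idempotent. -/
def idempotentApprox {S : Type*} [Ring S] (b : S) : ℕ → S
  | 0 => b
  | k + 1 => idempotentApprox b k + (1 - 2 * idempotentApprox b k) *
      (idempotentApprox b k * idempotentApprox b k - idempotentApprox b k)

theorem Commute.idempotentApprox_right {S : Type*} [Ring S] {a b : S} (h : Commute a b) (k : ℕ) :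
    Commute a (idempotentApprox b k) := by
  induction k with
  | zero => exact h
  | succ k ih =>
    have h2 : Commute a (2 : S) := Nat.cast_ofNat (R := S) (n := 2) ▸ Nat.commute_cast a 2
    exact ih.add_right (((Commute.one_right a).sub_right (h2.mul_right ih)).mul_right
      ((ih.mul_right ih).sub_right ih))

theorem exists_idempotentApprox_mul_self_sub {K S : Type*} [CommRing K] [Ring S] [Algebra K S]
    {x : K} {b : S} (hb : ∃ y : S, b * b - b = x • y) (k : ℕ) :
    ∃ y : S, idempotentApprox b k * idempotentApprox b k - idempotentApprox b k
      = x ^ (k + 1) • y := by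
  induction k with
  | zero => simpa [idempotentApprox] using hb
  | succ k ih =>
    obtain ⟨y, hy⟩ := ih
    simp only [idempotentApprox]
    -- The error is squared at each step, so the exponent is `2k + 2`; only `k + 2` is needed and
    -- the spare `x ^ k` goes into the witness.
    set e := idempotentApprox b k
    refine ⟨x ^ k • (y * y * (4 * (e * e - e) - 3)), ?_⟩
    calc _ = (e * e - e) * (e * e - e) * (4 * (e * e - e) - 3) := by noncomm_ring
      _ = _ := by
        nth_rw 1 [hy]
        nth_rw 1 [hy]
        simp only [smul_mul_assoc, mul_smul_comm, smul_smul]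
        congr 1
        ring

/-- Idempotents lift along the reduction modulo `X` of matrices over power series, and the lift
commutes with everything that commutes with a given approximate lift. -/
theorem PowerSeries.exists_isIdempotentElem_matrix {n R : Type*} [Fintype n] [DecidableEq n]
    [CommRing R] {B : Matrix n n (PowerSeries R)}
    (hB : IsIdempotentElem (B.map (PowerSeries.constantCoeff (R := R)))) :
    ∃ E : Matrix n n (PowerSeries R), IsIdempotentElem E ∧
      E.map (PowerSeries.constantCoeff (R := R)) = B.map (PowerSeries.constantCoeff (R := R)) ∧
      ∀ A, Commute A B → Commute A E := by
  have hB1 : ∃ Y : Matrix n n (PowerSeries R), B * B - B = (PowerSeries.X : PowerSeries R) • Y := by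
    have := PowerSeries.matrix_eq_X_pow_smul_of_coeff_eq_zero (M := B * B - B) (k := 1) (by
      intro i j c hc
      obtain rfl : c = 0 := by lia
      rw [PowerSeries.coeff_zero_eq_constantCoeff_apply]
      have h0 : PowerSeries.constantCoeff.mapMatrix (B * B - B) = 0 := by
        rw [map_sub, map_mul]
        exact sub_eq_zero.2 hB
      exact congrFun (congrFun h0 i) j)
    simpa using this
  have hy := exists_idempotentApprox_mul_self_sub hB1
  set e := idempotentApprox B with he
  have hstep (i j : n) (c k : ℕ) (hck : c ≤ k) :
      PowerSeries.coeff c (e k i j) = PowerSeries.coeff c (e c i j) := by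
    induction k, hck using Nat.le_induction with
    | base => rfl
    | succ k hk ih =>
      obtain ⟨y, hy⟩ := hy k
      have : e (k + 1) = e k + (PowerSeries.X : PowerSeries R) ^ (k + 1) •
          ((1 - 2 * e k) * y) := by
        rw [← mul_smul_comm, ← hy]
        rfl
      rw [this, Matrix.add_apply, map_add,
        PowerSeries.matrix_coeff_X_pow_smul _ (Nat.lt_succ_of_le hk), add_zero, ih]
  -- The `X`-adic limit: the coefficient of degree `c` is stable from iterate `c` on.
  let E : Matrix n n (PowerSeries R) :=
    Matrix.of fun i j => PowerSeries.mk fun c => PowerSeries.coeff c (e c i j)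
  have hE (k : ℕ) : ∃ Z, E - e k = (PowerSeries.X : PowerSeries R) ^ (k + 1) • Z := by
    refine PowerSeries.matrix_eq_X_pow_smul_of_coeff_eq_zero fun i j c hc => ?_
    rw [Matrix.sub_apply, map_sub, hstep i j c k (Nat.le_of_lt_succ hc)]
    simp [E]
  refine ⟨E, sub_eq_zero.1 ?_, ?_, fun A hA => sub_eq_zero.1 ?_⟩
  · refine PowerSeries.matrix_eq_zero_of_forall_X_pow_smul fun k => ?_
    obtain ⟨Z, hZ⟩ := hE k
    obtain ⟨Y, hY⟩ := hy k
    -- From `E² - E = (E - e)E + e(E - e) - (E - e) + (e² - e)`, where `e` is `e k`.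
    refine ⟨Z * E + e k * Z - Z + Y, ?_⟩
    rw [smul_add, smul_sub, smul_add, ← smul_mul_assoc, ← mul_smul_comm, ← hY, ← hZ]
    noncomm_ring
  · ext i j
    simp only [Matrix.map_apply, ← PowerSeries.coeff_zero_eq_constantCoeff_apply]
    simp [E, he, idempotentApprox]
  · refine PowerSeries.matrix_eq_zero_of_forall_X_pow_smul fun k => ?_
    obtain ⟨Z, hZ⟩ := hE k
    refine ⟨A * Z - Z * A, ?_⟩
    have hc := (hA.idempotentApprox_right k).eq
    rw [smul_sub, ← smul_mul_assoc _ Z A, ← mul_smul_comm _ A Z, ← hZ, mul_sub, sub_mul]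
    rw [← he] at hc
    rw [hc]
    abel

/-! ### Lifting cleanness from constant terms. -/

theorem PowerSeries.mem_jacobson_of_constantCoeff {R : Type*} [CommRing R] {p : PowerSeries R}
    (hp : PowerSeries.constantCoeff p ∈ Ring.jacobson R) : p ∈ Ring.jacobson (PowerSeries R) := by
  rw [← Ideal.jacobson_bot, Ideal.mem_jacobson_bot] at hp ⊢
  intro y
  rw [PowerSeries.isUnit_iff_constantCoeff]
  simpa using hp (PowerSeries.constantCoeff y)

theorem IsStronglyJSharpClean.of_map_constantCoeff {n R : Type*} [Fintype n] [DecidableEq n]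
    [CommRing R] {A : Matrix n n (PowerSeries R)}
    (h : IsStronglyJSharpClean (A.map (PowerSeries.constantCoeff (R := R)))) :
    IsStronglyJSharpClean A := by
  obtain ⟨E₀, hE₀, ⟨k, hk, hJ⟩, hcomm⟩ := h
  obtain ⟨g, hg⟩ := Matrix.exists_aeval_eq_of_isIdempotentElem hE₀ hcomm hJ
  have hB : (Polynomial.aeval A (g.map PowerSeries.C)).map
      (PowerSeries.constantCoeff (R := R)) = E₀ := by
    rw [← hg, ← RingHom.mapMatrix_apply, ← RingHom.mapMatrix_apply, Polynomial.aeval_def,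
      Polynomial.aeval_def, Polynomial.eval₂_map, Polynomial.hom_eval₂]
    congr 1
    ext r i j
    by_cases hij : i = j <;> simp [Matrix.algebraMap_matrix_apply, hij]
  obtain ⟨E, hE, hE0, hEc⟩ := PowerSeries.exists_isIdempotentElem_matrix (hB ▸ hE₀)
  rw [hB] at hE0
  refine ⟨E, hE, ⟨k, hk, Matrix.mem_jacobson_iff.2 fun i j =>
    PowerSeries.mem_jacobson_of_constantCoeff ?_⟩, (hEc A ?_).eq.symm⟩
  · have h1 : PowerSeries.constantCoeff.mapMatrix ((A - E) ^ k)
        = (A.map (PowerSeries.constantCoeff (R := R)) - E₀) ^ k := by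
      rw [map_pow, map_sub, ← hE0]
      rfl
    rw [← h1] at hJ
    exact Matrix.mem_jacobson_iff.1 hJ i j
  · simpa using (Commute.all Polynomial.X (g.map PowerSeries.C)).map (Polynomial.aeval A)

theorem theorem3p4 {R : Type u} [CommRing R] (hR : IsProjectiveFree R)
    (A : Matrix (Fin 3) (Fin 3) (PowerSeries R)) (m : ℕ) (hm : 1 ≤ m) :
    List.TFAE [
      IsStronglyJSharpClean A,
      IsStronglyJSharpClean
        (A.map (Ideal.Quotient.mk (Ideal.span {(PowerSeries.X : PowerSeries R) ^ m}))),
      IsStronglyJSharpClean (A.map (PowerSeries.constantCoeff (R := R)))] := by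
  tfae_have 1 → 2 := fun h => h.matrix_map _ Ideal.Quotient.mk_surjective
  tfae_have 2 → 3 := fun h => by
    have hker : ∀ p ∈ Ideal.span {(PowerSeries.X : PowerSeries R) ^ m},
        PowerSeries.constantCoeff p = 0 := by
      intro p hp
      obtain ⟨q, rfl⟩ := Ideal.mem_span_singleton.1 hp
      simp [Nat.one_le_iff_ne_zero.1 hm]
    exact h.matrix_map (Ideal.Quotient.lift _ PowerSeries.constantCoeff hker)
      (Ideal.Quotient.lift_surjective_of_surjective _ _ PowerSeries.constantCoeff_surj)
  tfae_have 3 → 1 := IsStronglyJSharpClean.of_map_constantCoeff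
  tfae_finish
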